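/- **Theorem (Spanner lower bound).** For a finite undirected unweighted graph $G=(V,E)$, an additive spanner of $G$ with stretch $\beta$ is a subgraph $H\subseteq G$ on the vertex set $V$ such that $\mathrm{dist}_G(u,v)\le \mathrm{dist}_H(u,v)\le \mathrm{dist}_G(u,v)+\beta$ for all $u,v\in V$ (distances between vertices in different components being $\infty$). There exist undirected graphs $(G_n)_{n\ge 0}$, where $G_n$ has $n$ vertices, such that every spanner of $G_n$ with $O(n)$ edges has additive stretch $\Omega(n^{2/21})$. That is, for every constant $C$ there are a constant $c>0$ and an integer $N$, depending only on $C$, such that for every $n\ge N$, every additive spanner of $G_n$ with at most $C\,n$ edges and stretch $\beta\in\mathbb{N}$ satisfies $\beta\ge c\,n^{2/21}$. -/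

import Mathlib

/-- `H` is an additive spanner of the unweighted undirected graph `G` with additive stretch (at
most) `β`: it is a subgraph of `G` on the same vertex set, and for all vertices `u`, `v`,
`dist_G(u,v) ≤ dist_H(u,v) ≤ dist_G(u,v) + β`. Distances are `ℕ∞`-valued, with value `⊤` between
vertices in different components, so that `H` has to keep connected what `G` connects. -/
def IsAdditiveSpanner {V : Type*} (G H : SimpleGraph V) (β : ℕ) : Prop :=
  H ≤ G ∧ ∀ u v : V, G.edist u v ≤ H.edist u v ∧ H.edist u v ≤ G.edist u v + (β : ℕ∞)

/-! The proof is an obstacle product over an alternating layered graph.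

The outer graph has vertices `(i, x)` with `i` a layer and `x` in a finite abelian group `A`. From
`(i, x)` there are `d` edges to layer `i + 1`, the one with label `a < d` leading to
`(i + 1, x + w i a)`. The group is a product of three cyclic groups, and `w i a` is `(a, 0, a²)` in
even layers and `(0, a, a²)` in odd layers. A path whose labels alternate `a, b, a, b, …` is the only
layered path between its ends: the first two coordinates give the sums of the labels over the
even and over the odd layers, the third one gives the sum of all their squares, and the sum of the
squared deviations from `a, b, a, b, …` then vanishes (`labels_eq_alternating`). The moduli exceed
all sums that occur, so that congruences are equalities. Moreover an alternating path
is determined by any two consecutive edges of it.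

In the graph of the theorem (`productGraph`), every outer edge becomes a path with `D` edges, and
every outer vertex becomes the complete bipartite graph between the ends of the incoming and the
beginnings of the outgoing edges. Each step moves by exactly one along the function
`i (D + 1) + j`, where `j` is the position on the subdivided edge. A walk from the first
to the last layer is therefore longer than an alternating path by twice the number `B` of its
backward steps. When `B ≤ D`, the walk cannot go backwards through a whole subdivided edge, hence it
follows a layered path, and each bipartite edge of that path missing from the subgraph
costs it a backward step (`exists_backward_steps`). Hence, in a spanner with stretch less than the
number `L` of crossings, each alternating path retains at least half of its bipartite edges. No
bipartite edge is on two alternating paths, so that the spanner has at least `|A| d² L / 2` edges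
(`card_mul_le_two_mul_ncard_edgeSet`).

With `D = L = t ^ 10` and `d = t ^ 11`, there are `Θ(t ^ 105)` vertices, while a spanner with stretch
less than `t ^ 10` has `Ω(t ^ 106)` edges. This is superlinear, which is why the same graphs serve for
all constants `C`, and `t ^ 10` is of the order of `n ^ (2 / 21)`. -/

/-! ### The product graph -/

/-- The vertices `(i, x, a, j)` of the product graph: the position `j` on the subdivided outer edge
that leaves the outer vertex `x` of layer `i` with label `a`. The positions range over `0, …, D`, and
the labels over `0, …, d - 1`; quadruples with other positions or labels are isolated. The layers are
not bounded, as finite vertex sets are cut out only by `exists_graph`. -/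
abbrev ProductVertex (A : Type*) : Type _ := ℕ × A × ℕ × ℕ

/-- The forward steps of the product graph: along a subdivided edge, and from the end of an edge to
the beginning of any edge that leaves its head. -/
inductive ForwardStep {A : Type*} [Add A] (w : ℕ → ℕ → A) (d D : ℕ) :
    ProductVertex A → ProductVertex A → Prop
  | along (i : ℕ) (x : A) (a j : ℕ) (ha : a < d) (hj : j < D) :
      ForwardStep w d D (i, x, a, j) (i, x, a, j + 1)
  | cross (i : ℕ) (x : A) (a b : ℕ) (ha : a < d) (hb : b < d) :
      ForwardStep w d D (i, x, a, D) (i + 1, x + w i a, b, 0)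

/-- The product graph with edge labels `0, …, d - 1`, outer edges subdivided into `D` edges, and
translation `w i a` along the outer edges of layer `i` and label `a`. -/
def productGraph {A : Type*} [Add A] (w : ℕ → ℕ → A) (d D : ℕ) :
    SimpleGraph (ProductVertex A) where
  Adj u v := ForwardStep w d D u v ∨ ForwardStep w d D v u
  symm := ⟨fun _ _ h => h.symm⟩
  loopless := ⟨by
    rintro ⟨i, x, a, j⟩ (h | h) <;>
    · generalize hu : (i, x, a, j) = u at h
      generalize hv : u = v at h
      subst hu
      cases h⟩

/-- The outer vertex reached from `x` in layer `0` by following the labels `c` up to layer `k`. -/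
def outerVertex {A : Type*} [AddCommMonoid A] (w : ℕ → ℕ → A) (x : A) (c : ℕ → ℕ) (k : ℕ) : A :=
  x + ∑ i ∈ Finset.range k, w i (c i)

/-- The subgraph `H` contains the bipartite edge used between layers `k` and `k + 1` by the path from
`x` with labels `c`. -/
def Crosses {A : Type*} [AddCommMonoid A] (w : ℕ → ℕ → A) (D : ℕ)
    (H : SimpleGraph (ProductVertex A)) (x : A) (c : ℕ → ℕ) (k : ℕ) : Prop :=
  H.Adj (k, outerVertex w x c k, c k, D) (k + 1, outerVertex w x c (k + 1), c (k + 1), 0)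

open Classical in
/-- The number of bipartite edges missing from `H` among the first `m` on the path from `x` with
labels `c`. -/
noncomputable def missing {A : Type*} [AddCommMonoid A] (w : ℕ → ℕ → A) (D : ℕ)
    (H : SimpleGraph (ProductVertex A)) (x : A) (c : ℕ → ℕ) (m : ℕ) : ℕ :=
  ((Finset.range m).filter fun k => ¬ Crosses w D H x c k).card

section Walks

variable {A : Type*} [AddCommGroup A] {w : ℕ → ℕ → A} {d D : ℕ} {H : SimpleGraph (ProductVertex A)}
  {x : A} {c c' : ℕ → ℕ} {m : ℕ}

lemma outerVertex_succ : outerVertex w x c (m + 1) = outerVertex w x c m + w m (c m) := by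
  simp [outerVertex, Finset.sum_range_succ, add_assoc]

lemma outerVertex_congr (h : ∀ k < m, c k = c' k) : outerVertex w x c m = outerVertex w x c' m := by
  unfold outerVertex
  congr 1
  exact Finset.sum_congr rfl fun k hk => by rw [h k (Finset.mem_range.1 hk)]

lemma crosses_congr (h : ∀ k ≤ m + 1, c k = c' k) :
    Crosses w D H x c m ↔ Crosses w D H x c' m := by
  unfold Crosses
  rw [outerVertex_congr (m := m) (c' := c') fun k hk => h k (by omega),
    outerVertex_congr (m := m + 1) (c' := c') fun k hk => h k (by omega), h m (by omega),
    h (m + 1) le_rfl]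

lemma missing_congr (h : ∀ k ≤ m, c k = c' k) : missing w D H x c m = missing w D H x c' m := by
  classical
  unfold missing
  congr 1
  refine Finset.filter_congr fun k hk => not_congr (crosses_congr fun l hl => h l ?_)
  have := Finset.mem_range.1 hk
  omega

lemma missing_zero : missing w D H x c 0 = 0 := by simp [missing]

lemma missing_succ_le : missing w D H x c (m + 1) ≤ missing w D H x c m + 1 := by
  classical
  unfold missing
  rw [Finset.range_add_one, Finset.filter_insert]
  split_ifs
  · omega
  · exact Finset.card_insert_le _ _

lemma missing_succ_of_crosses (h : Crosses w D H x c m) :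
    missing w D H x c (m + 1) = missing w D H x c m := by
  classical
  unfold missing
  rw [Finset.range_add_one, Finset.filter_insert, if_neg (not_not.2 h)]

/-! ### Walks with few backward steps -/

/-- The vertex `u` lies on the layered path from `x` with some labels, and at most `B` bipartite
edges on the way to it are missing from `H`. -/
def Follows (w : ℕ → ℕ → A) (d D : ℕ) (H : SimpleGraph (ProductVertex A)) (x : A) (B : ℕ)
    (u : ProductVertex A) : Prop :=
  ∃ c : ℕ → ℕ, (∀ k ≤ u.1, c k < d) ∧ u.2.1 = outerVertex w x c u.1 ∧ u.2.2.1 = c u.1 ∧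
    missing w D H x c u.1 ≤ B

/-- The vertex `u` lies on a subdivided edge whose head is on the layered path from `x` with some
labels. This edge has been entered backwards from its head, so that, apart from the
missing bipartite edges, the backward steps account for the one into the edge and for the distance
`D - j` of `u` from its end. -/
def Retreats (w : ℕ → ℕ → A) (d D : ℕ) (H : SimpleGraph (ProductVertex A)) (x : A) (B : ℕ)
    (u : ProductVertex A) : Prop :=
  ∃ c : ℕ → ℕ, (∀ k ≤ u.1, c k < d) ∧ u.2.1 + w u.1 u.2.2.1 = outerVertex w x c (u.1 + 1) ∧
    missing w D H x c u.1 + 1 + D ≤ B + u.2.2.2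

/-- A walk of `H` from the first layer has length `i (D + 1) + j + 2 B`, where `B` is the number of
its backward steps; unless `B > D`, it ends on a layered path with at most `B` missing edges, or on
a subdivided edge entered backwards from such a path. -/
lemma exists_backward_steps (hH : H ≤ productGraph w d D) {a : ℕ} (ha : a < d)
    {u s : ProductVertex A} (hs : s = (0, x, a, 0)) (p : H.Walk u s) :
    ∃ B : ℕ, p.length = u.1 * (D + 1) + u.2.2.2 + 2 * B ∧
      (B ≤ D → Follows w d D H x B u ∨ Retreats w d D H x B u) := by
  induction p with
  | nil =>
    subst hs
    exact ⟨0, by simp, fun _ => Or.inl ⟨fun _ => a, fun _ _ => ha, by simp [outerVertex], rfl,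
      by simp [missing_zero]⟩⟩
  | @cons u v s h p ih =>
    obtain ⟨B, hB, hinv⟩ := ih hs
    rw [SimpleGraph.Walk.length_cons, hB]
    rcases hH h with h' | h'
    · -- Along the walk read from `s`, this is the backward step from `v` to `u`.
      refine ⟨B + 1, ?_, fun hBD => ?_⟩
      · cases h' <;> simp only <;> ring
      have hinv := hinv (by omega)
      cases h' with
      | along i y b j hb hj =>
        rcases hinv with ⟨c, h1, h2, h3, h4⟩ | ⟨c, h1, h2, h3⟩
        · exact Or.inl ⟨c, h1, h2, h3, by simp only at h4 ⊢; omega⟩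
        · exact Or.inr ⟨c, h1, h2, by simp only at h3 ⊢; omega⟩
      | cross i y b b' hb hb' =>
        rcases hinv with ⟨c, h1, h2, h3, h4⟩ | ⟨c, h1, h2, h3⟩
        · refine Or.inr ⟨c, fun k hk => h1 k (Nat.le_succ_of_le hk), h2, ?_⟩
          have : missing w D H x c i ≤ missing w D H x c (i + 1) := by
            classical
            exact Finset.card_le_card (Finset.filter_subset_filter _
              (Finset.range_subset_range.2 (Nat.le_succ i)))
          simp only at h4 ⊢
          omega
        · -- Here the walk would have retreated through all of a subdivided edge.
          simp only at h3
          omega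
    · refine ⟨B, ?_, fun hBD => ?_⟩
      · cases h' <;> simp only <;> ring
      have hinv := hinv hBD
      cases h' with
      | along i y b j hb hj =>
        rcases hinv with ⟨c, h1, h2, h3, h4⟩ | ⟨c, h1, h2, h3⟩
        · exact Or.inl ⟨c, h1, h2, h3, h4⟩
        · exact Or.inr ⟨c, h1, h2, by simp only at h3 ⊢; omega⟩
      | cross i y b b' hb hb' =>
        left
        have key : ∀ c : ℕ → ℕ, (∀ k ≤ i, c k < d) → y + w i b = outerVertex w x c (i + 1) →
            (missing w D H x c i + 1 ≤ B ∨
              (y = outerVertex w x c i ∧ b = c i ∧ missing w D H x c i ≤ B)) →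
            Follows w d D H x B (i + 1, y + w i b, b', 0) := by
          intro c h1 h2 h3
          let c' : ℕ → ℕ := fun k => if k ≤ i then c k else b'
          have hc : ∀ k ≤ i, c k = c' k := fun k hk => by simp [c', hk]
          have hc' : c' (i + 1) = b' := by simp [c']
          have hv : outerVertex w x c (i + 1) = outerVertex w x c' (i + 1) :=
            outerVertex_congr fun k hk => hc k (by omega)
          refine ⟨c', fun k _ => ?_, h2.trans hv, hc'.symm, ?_⟩
          · by_cases hk : k ≤ i
            · rw [← hc k hk]; exact h1 k hk
            · simpa [c', hk] using hb'
          · have hm : missing w D H x c i = missing w D H x c' i := missing_congr hc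
            simp only
            rcases h3 with h3 | ⟨h3, h4, h5⟩
            · have := missing_succ_le (w := w) (D := D) (H := H) (x := x) (c := c') (m := i)
              omega
            · rw [missing_succ_of_crosses, ← hm]
              · exact h5
              · unfold Crosses
                rw [← hv, ← h2, hc', ← hc i le_rfl, ← h4,
                  ← outerVertex_congr (fun k hk => hc k (Nat.le_of_lt hk)), ← h3]
                exact h.symm
        rcases hinv with ⟨c, h1, h2, h3, h4⟩ | ⟨c, h1, h2, h3⟩
        · simp only at h1 h2 h3 h4
          exact key c h1 (by rw [outerVertex_succ, ← h2, ← h3]) (Or.inr ⟨h2, h3, h4⟩)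
        · exact key c h1 h2 (Or.inl (by simp only at h3; omega))

/-- If the path from `x` with labels `c` is the only layered path between its ends, then a walk of
`H` between the corresponding vertices that exceeds the path by at most `β ≤ D` forces all but
`β / 2` of the bipartite edges of the path to be in `H`. -/
lemma two_mul_missing_le (hH : H ≤ productGraph w d D) {L β : ℕ} (hβ : β ≤ D)
    (hc : ∀ k, c k < d)
    (hunique : ∀ c' : ℕ → ℕ, (∀ k ≤ L, c' k < d) →
      outerVertex w x c' (L + 1) = outerVertex w x c (L + 1) → ∀ k ≤ L, c' k = c k)
    (p : H.Walk (L, outerVertex w x c L, c L, D) (0, x, c 0, 0))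
    (hp : p.length ≤ L * (D + 1) + D + β) :
    2 * missing w D H x c L ≤ β := by
  obtain ⟨B, hB, hinv⟩ := exists_backward_steps hH (hc 0) rfl p
  simp only at hB
  rcases hinv (by omega) with ⟨c', h1, h2, h3, h4⟩ | ⟨c', h1, h2, h3⟩
  · simp only at h1 h2 h3 h4
    have := hunique c' h1 (by rw [outerVertex_succ, outerVertex_succ, ← h2, ← h3])
    rw [missing_congr this] at h4
    omega
  · simp only at h1 h2 h3
    have := hunique c' h1 (by rw [← h2, outerVertex_succ])
    rw [missing_congr this] at h3
    omega

end Walks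

/-! ### Alternating paths -/

/-- The labels `a, b, a, b, …`. -/
def alternating (a b k : ℕ) : ℕ := if Even k then a else b

lemma alternating_lt {a b d : ℕ} (ha : a < d) (hb : b < d) (k : ℕ) : alternating a b k < d := by
  unfold alternating
  split_ifs <;> assumption

/-- Two consecutive alternating labels, with the parity of their place, determine the sequence. -/
lemma eq_of_alternating_eq {a b a' b' k : ℕ} (h : alternating a b k = alternating a' b' k)
    (h' : alternating a b (k + 1) = alternating a' b' (k + 1)) : a = a' ∧ b = b' := by
  unfold alternating at h h'
  rcases Nat.even_or_odd k with hk | hk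
  · simp only [hk, Nat.even_add_one, not_true_eq_false, if_true, if_false] at h h'
    exact ⟨h, h'⟩
  · rw [← Nat.not_even_iff_odd] at hk
    simp only [hk, Nat.even_add_one, not_false_eq_true, if_true, if_false] at h h'
    exact ⟨h', h⟩

open Classical in
/-- If all alternating paths are the only layered paths between their ends, and `H` joins those
ends by walks that exceed the alternating paths by less than the number `L` of crossings, then `H`
contains at least half of the bipartite edges of each alternating path. -/
lemma card_mul_le_two_mul_ncard_edgeSet {A : Type*} [AddCommGroup A] [Fintype A]
    {w : ℕ → ℕ → A} {d D L β : ℕ} {H : SimpleGraph (ProductVertex A)}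
    (hH : H ≤ productGraph w d D) (hfin : H.edgeSet.Finite) (hβ : β < L) (hD : L ≤ D)
    (hunique : ∀ (x : A) (a b : ℕ), a < d → b < d → ∀ c : ℕ → ℕ, (∀ k ≤ L, c k < d) →
      outerVertex w x c (L + 1) = outerVertex w x (alternating a b) (L + 1) →
      ∀ k ≤ L, c k = alternating a b k)
    (hwalk : ∀ (x : A) (a b : ℕ), a < d → b < d →
      ∃ p : H.Walk (L, outerVertex w x (alternating a b) L, alternating a b L, D)
        (0, x, alternating a b 0, 0), p.length ≤ L * (D + 1) + D + β) :
    Fintype.card A * d ^ 2 * L ≤ 2 * H.edgeSet.ncard := by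
  let P : Finset (A × ℕ × ℕ) := Finset.univ ×ˢ Finset.range d ×ˢ Finset.range d
  let Q : Finset ((A × ℕ × ℕ) × ℕ) := (P ×ˢ Finset.range L).filter fun q =>
    Crosses w D H q.1.1 (alternating q.1.2.1 q.1.2.2) q.2
  have hhalf : ∀ q ∈ P, L ≤ 2 * ((Finset.range L).filter fun k =>
      Crosses w D H q.1 (alternating q.2.1 q.2.2) k).card := by
    rintro ⟨x, a, b⟩ hq
    simp only [P, Finset.mem_product, Finset.mem_univ, Finset.mem_range, true_and] at hq
    obtain ⟨p, hp⟩ := hwalk x a b hq.1 hq.2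
    have h1 := two_mul_missing_le hH (by omega) (alternating_lt hq.1 hq.2)
      (hunique x a b hq.1 hq.2) p hp
    have h2 := Finset.card_filter_add_card_filter_not (s := Finset.range L)
      fun k => Crosses w D H x (alternating a b) k
    unfold missing at h1
    rw [Finset.card_range] at h2
    simp only
    omega
  have hQ : Fintype.card A * d ^ 2 * L ≤ 2 * Q.card := by
    have hP : P.card = Fintype.card A * d ^ 2 := by
      simp [P, sq]
    have hsum : Q.card = ∑ q ∈ P, ((Finset.range L).filter fun k =>
        Crosses w D H q.1 (alternating q.2.1 q.2.2) k).card := by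
      simp only [Q, Finset.card_filter, Finset.sum_product]
    rw [hsum, Finset.mul_sum, ← hP, ← smul_eq_mul]
    exact Finset.card_nsmul_le_sum _ _ _ hhalf
  refine hQ.trans (Nat.mul_le_mul_left 2 ?_)
  rw [← Set.ncard_coe_finset]
  refine Set.ncard_le_ncard_of_injOn (fun q =>
    s((q.2, outerVertex w q.1.1 (alternating q.1.2.1 q.1.2.2) q.2,
        alternating q.1.2.1 q.1.2.2 q.2, D),
      (q.2 + 1, outerVertex w q.1.1 (alternating q.1.2.1 q.1.2.2) (q.2 + 1),
        alternating q.1.2.1 q.1.2.2 (q.2 + 1), 0))) ?_ ?_ hfin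
  · intro q hq
    exact (Finset.mem_filter.1 hq).2
  · rintro ⟨⟨x, a, b⟩, k⟩ _ ⟨⟨x', a', b'⟩, k'⟩ _ h
    simp only [Sym2.eq_iff, Prod.mk.injEq] at h
    rcases h with ⟨⟨rfl, h1, h2, -⟩, -, -, h3, -⟩ | ⟨⟨h1, -⟩, h2, -⟩
    · obtain ⟨rfl, rfl⟩ := eq_of_alternating_eq h2 h3
      have : x = x' := add_right_cancel h1
      rw [this]
    · omega

/-! ### Uniqueness of the alternating paths -/

/-- The translations of the outer graph: an even layer records its labels in the first coordinate,
an odd one in the second, and both record the squares in the third. -/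
def translation (M M' : ℕ) (i a : ℕ) : ZMod M × ZMod M × ZMod M' :=
  if Even i then ((a : ZMod M), 0, (a : ZMod M') ^ 2) else (0, (a : ZMod M), (a : ZMod M') ^ 2)

lemma sum_lt_mul {L M : ℕ} {f : ℕ → ℕ} (h : ∀ k < L + 1, f k < M) :
    ∑ k ∈ Finset.range (L + 1), f k < (L + 1) * M := by
  have := Finset.sum_lt_sum_of_nonempty (s := Finset.range (L + 1)) (by simp)
    fun k hk => h k (Finset.mem_range.1 hk)
  simpa using this

lemma sum_eq_of_sum_cast_eq {L M : ℕ} {f g : ℕ → ℕ} (hf : ∀ k < L + 1, f k < M)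
    (hg : ∀ k < L + 1, g k < M)
    (h : ∑ k ∈ Finset.range (L + 1), (f k : ZMod ((L + 1) * M)) =
      ∑ k ∈ Finset.range (L + 1), (g k : ZMod ((L + 1) * M))) :
    ∑ k ∈ Finset.range (L + 1), f k = ∑ k ∈ Finset.range (L + 1), g k := by
  rw [← Nat.cast_sum, ← Nat.cast_sum, ZMod.natCast_eq_natCast_iff] at h
  exact h.eq_of_lt_of_lt (sum_lt_mul hf) (sum_lt_mul hg)

/-- A layered path with the same ends as an alternating path coincides with it. -/
lemma labels_eq_alternating {L d : ℕ}
    (x : ZMod ((L + 1) * d) × ZMod ((L + 1) * d) × ZMod ((L + 1) * d ^ 2)) {a b : ℕ}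
    (ha : a < d) (hb : b < d) {c : ℕ → ℕ} (hc : ∀ k ≤ L, c k < d)
    (h : outerVertex (translation ((L + 1) * d) ((L + 1) * d ^ 2)) x c (L + 1) =
      outerVertex (translation ((L + 1) * d) ((L + 1) * d ^ 2)) x (alternating a b) (L + 1)) :
    ∀ k ≤ L, c k = alternating a b k := by
  have h := add_left_cancel h
  have halt := alternating_lt ha hb
  have hd : 0 < d := by omega
  have h1 : ∑ k ∈ Finset.range (L + 1), (if Even k then c k else 0) =
      ∑ k ∈ Finset.range (L + 1), (if Even k then alternating a b k else 0) := by
    refine sum_eq_of_sum_cast_eq (M := d) (fun k hk => ?_) (fun k hk => ?_) ?_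
    · split_ifs
      exacts [hc k (by omega), hd]
    · split_ifs
      exacts [halt k, hd]
    · have := congrArg Prod.fst h
      simp only [Prod.fst_sum] at this
      convert this using 2 with k _ k _ <;> unfold translation <;> split_ifs <;> simp
  have h2 : ∑ k ∈ Finset.range (L + 1), (if Even k then 0 else c k) =
      ∑ k ∈ Finset.range (L + 1), (if Even k then 0 else alternating a b k) := by
    refine sum_eq_of_sum_cast_eq (M := d) (fun k hk => ?_) (fun k hk => ?_) ?_
    · split_ifs
      exacts [hd, hc k (by omega)]
    · split_ifs
      exacts [hd, halt k]
    · have := congrArg (fun z => z.2.1) h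
      simp only [Prod.fst_sum, Prod.snd_sum] at this
      convert this using 2 with k _ k _ <;> unfold translation <;> split_ifs <;> simp
  have h3 : ∑ k ∈ Finset.range (L + 1), c k ^ 2 =
      ∑ k ∈ Finset.range (L + 1), alternating a b k ^ 2 := by
    refine sum_eq_of_sum_cast_eq (M := d ^ 2) (fun k hk => ?_) (fun k hk => ?_) ?_
    · exact Nat.pow_lt_pow_left (hc k (by omega)) two_ne_zero
    · exact Nat.pow_lt_pow_left (halt k) two_ne_zero
    · have := congrArg (fun z => z.2.2) h
      simp only [Prod.snd_sum] at this
      convert this using 2 with k _ k _ <;> unfold translation <;> split_ifs <;> simp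
  have hz : ∑ k ∈ Finset.range (L + 1), ((c k : ℤ) - alternating a b k) ^ 2 = 0 := by
    have h1' := congrArg (fun m : ℕ => (m : ℤ)) h1
    have h2' := congrArg (fun m : ℕ => (m : ℤ)) h2
    have h3' := congrArg (fun m : ℕ => (m : ℤ)) h3
    push_cast at h1' h2' h3'
    -- Expanding the square, `c k * alternating a b k` is `a` or `b` times `c k`.
    have hexp : ∀ k, ((c k : ℤ) - alternating a b k) ^ 2 = (c k : ℤ) ^ 2 - alternating a b k ^ 2
        - 2 * a * ((if Even k then (c k : ℤ) else 0) - if Even k then (alternating a b k : ℤ) else 0)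
        - 2 * b * ((if Even k then 0 else (c k : ℤ)) -
            if Even k then 0 else (alternating a b k : ℤ)) := by
      intro k
      unfold alternating
      split_ifs <;> ring
    simp only [hexp, Finset.sum_sub_distrib, ← Finset.mul_sum]
    rw [h1', h2', h3']
    ring
  intro k hk
  have := (Finset.sum_eq_zero_iff_of_nonneg fun k _ => sq_nonneg _).1 hz k
    (Finset.mem_range.2 (by omega))
  have := pow_eq_zero_iff (two_ne_zero) |>.1 this
  omega

/-! ### Graphs on a prescribed number of vertices -/

/-- A layered path, run through one edge at a time, bounds the distances in every graph induced on a
set of vertices that contains it. -/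
lemma edist_le_of_layered_path {A V : Type*} [AddCommGroup A] {w : ℕ → ℕ → A} {d D L : ℕ}
    (g : V ↪ ProductVertex A) {x : A} {c : ℕ → ℕ} (hc : ∀ k, c k < d)
    (hg : ∀ i ≤ L, ∀ j ≤ D, ∃ v, g v = (i, outerVertex w x c i, c i, j)) {s : V}
    (hs : g s = (0, x, c 0, 0)) :
    ∀ i ≤ L, ∀ j ≤ D, ∀ v, g v = (i, outerVertex w x c i, c i, j) →
      ((productGraph w d D).comap g).edist v s ≤ (i * (D + 1) + j : ℕ) := by
  have hstep : ∀ (m : ℕ) (u v : V), ForwardStep w d D (g u) (g v) →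
      ((productGraph w d D).comap g).edist u s ≤ (m : ℕ) →
      ((productGraph w d D).comap g).edist v s ≤ (m + 1 : ℕ) := by
    intro m u v h hu
    refine (SimpleGraph.edist_triangle (v := u)).trans ?_
    have h1 : ((productGraph w d D).comap g).edist v u = 1 :=
      SimpleGraph.edist_eq_one_iff_adj.2 (Or.inr h)
    rw [h1, add_comm, Nat.cast_add, Nat.cast_one]
    gcongr
  intro i
  induction i with
  | zero =>
    intro hi j
    induction j with
    | zero =>
      intro _ v hv
      have : v = s := g.injective (by rw [hv, hs]; simp [outerVertex])
      simp [this]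
    | succ j ih =>
      intro hj v hv
      obtain ⟨u, hu⟩ := hg 0 hi j (by omega)
      exact hstep _ u v (by rw [hu, hv]; exact .along _ _ _ _ (hc 0) hj) (ih (by omega) u hu)
  | succ i ihi =>
    intro hi j
    induction j with
    | zero =>
      intro _ v hv
      obtain ⟨u, hu⟩ := hg i (by omega) D le_rfl
      have := hstep _ u v (by rw [hu, hv, outerVertex_succ]; exact .cross _ _ _ _ (hc i) (hc _))
        (ihi (by omega) D le_rfl u hu)
      rwa [show (i + 1) * (D + 1) + 0 = i * (D + 1) + D + 1 by ring]
    | succ j ih =>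
      intro hj v hv
      obtain ⟨u, hu⟩ := hg (i + 1) hi j (by omega)
      exact hstep _ u v (by rw [hu, hv]; exact .along _ _ _ _ (hc _) hj) (ih (by omega) u hu)

/-- For `d ≥ 1` and every `n ≥ (L + 1) ^ 5 d ^ 5` there is a graph with `n` vertices, each
spanner of which has stretch at least `L` or at least `L ^ 4 d ^ 6 / 2` edges. -/
lemma exists_graph {L d n : ℕ} (hd : 0 < d) (hn : (L + 1) ^ 5 * d ^ 5 ≤ n) :
    ∃ G : SimpleGraph (Fin n), ∀ (H : SimpleGraph (Fin n)) (β : ℕ), IsAdditiveSpanner G H β →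
      L ≤ β ∨ L ^ 4 * d ^ 6 ≤ 2 * H.edgeSet.ncard := by
  classical
  have : NeZero ((L + 1) * d) := ⟨by positivity⟩
  have : NeZero ((L + 1) * d ^ 2) := ⟨by positivity⟩
  let A := ZMod ((L + 1) * d) × ZMod ((L + 1) * d) × ZMod ((L + 1) * d ^ 2)
  let w : ℕ → ℕ → A := translation ((L + 1) * d) ((L + 1) * d ^ 2)
  have hA : Fintype.card A = (L + 1) ^ 3 * d ^ 4 := by
    simp only [A, Fintype.card_prod, ZMod.card]
    ring
  let S : Finset (ProductVertex A) :=
    Finset.range (L + 1) ×ˢ Finset.univ ×ˢ Finset.range d ×ˢ Finset.range (L + 1)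
  have hS : S.card ≤ n := by
    refine le_trans (le_of_eq ?_) hn
    simp only [S, Finset.card_product, Finset.card_range, Finset.card_univ, hA]
    ring
  obtain ⟨T, hST, hT⟩ := Infinite.exists_superset_card_eq S n hS
  let g : Fin n ↪ ProductVertex A :=
    (T.equivFinOfCardEq hT).symm.toEmbedding.trans (Function.Embedding.subtype _)
  have hg : ∀ i ≤ L, ∀ y : A, ∀ a < d, ∀ j ≤ L, ∃ v, g v = (i, y, a, j) := by
    intro i hi y a ha j hj
    have hmem : ((i, y, a, j) : ProductVertex A) ∈ T := hST (by
      simp only [S, Finset.mem_product, Finset.mem_range, Finset.mem_univ, true_and]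
      omega)
    exact ⟨T.equivFinOfCardEq hT ⟨_, hmem⟩, by simp [g]⟩
  refine ⟨(productGraph w d L).comap g, fun H β hspan => ?_⟩
  rcases Nat.lt_or_ge β L with hβ | hβ
  · right
    have hcard : (H.map g).edgeSet.ncard = H.edgeSet.ncard := by
      rw [SimpleGraph.edgeSet_map]
      exact Set.ncard_image_of_injective _ g.sym2Map.injective
    have hfin : (H.map g).edgeSet.Finite := by
      rw [SimpleGraph.edgeSet_map]
      exact (Set.toFinite _).image _
    have hle := card_mul_le_two_mul_ncard_edgeSet (H := H.map g) (w := w) (d := d) (D := L)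
      ((SimpleGraph.map_le_iff_le_comap _ _ _).2 hspan.1) hfin hβ le_rfl
      (fun x a b ha hb c hc h => labels_eq_alternating x ha hb hc h) ?_
    · rw [hcard, hA] at hle
      refine le_trans ?_ hle
      calc L ^ 4 * d ^ 6 = L ^ 3 * d ^ 4 * d ^ 2 * L := by ring
        _ ≤ (L + 1) ^ 3 * d ^ 4 * d ^ 2 * L := by gcongr; omega
    · intro x a b ha hb
      have halt := alternating_lt ha hb
      obtain ⟨s, hs⟩ := hg 0 (Nat.zero_le _) x (alternating a b 0) (halt 0) 0 (Nat.zero_le _)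
      obtain ⟨v, hv⟩ := hg L le_rfl (outerVertex w x (alternating a b) L) (alternating a b L)
        (halt L) L le_rfl
      have hG := edist_le_of_layered_path g halt
        (fun i hi j hj => hg i hi _ _ (halt i) j hj) hs L le_rfl L le_rfl v hv
      have hHle : H.edist v s ≤ (L * (L + 1) + L + β : ℕ) := by
        refine (hspan.2 v s).2.trans ?_
        rw [Nat.cast_add _ β]
        gcongr
      obtain ⟨p, hp⟩ := SimpleGraph.exists_walk_of_edist_ne_top
        (ne_top_of_le_ne_top (ENat.natCast_ne_top _) hHle)
      rw [← hp, Nat.cast_le] at hHle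
      rw [← hv, ← hs]
      exact ⟨p.map (SimpleGraph.Embedding.map g H).toHom,
        (SimpleGraph.Walk.length_map _ _).trans_le hHle⟩
  · exact Or.inl hβ

/-! ### Choice of the parameters -/

lemma exists_le_lt_succ (f : ℕ → ℕ) {n m : ℕ} (h0 : f 0 ≤ n) (hm : n < f m) :
    ∃ t, f t ≤ n ∧ n < f (t + 1) := by
  induction m with
  | zero => omega
  | succ m ih =>
    rcases Nat.lt_or_ge n (f m) with h | h
    exacts [ih h, ⟨m, h, hm⟩]

/-- The graphs of `exists_graph` with `L = t ^ 10` and `d = t ^ 11`, where `t` is the largest number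
with `32 t ^ 105 ≤ n`. For `t = 0` the bound on the stretch is void, and any graph will do. -/
lemma exists_graph_of_card (n : ℕ) :
    ∃ (G : SimpleGraph (Fin n)) (t : ℕ), n < 32 * (t + 1) ^ 105 ∧
      ∀ (H : SimpleGraph (Fin n)) (β : ℕ), IsAdditiveSpanner G H β →
        t ^ 10 ≤ β ∨ t ^ 106 ≤ 2 * H.edgeSet.ncard := by
  obtain ⟨t, ht, ht'⟩ := exists_le_lt_succ (fun t => 32 * t ^ 105) (m := n + 1) (Nat.zero_le n) (by
    have := Nat.le_self_pow (n := 105) (by norm_num) (n + 1)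
    change n < 32 * (n + 1) ^ 105
    linarith)
  rcases Nat.eq_zero_or_pos t with h0 | hpos
  · refine ⟨⊥, t, ht', fun H β _ => Or.inl ?_⟩
    rw [h0]
    exact Nat.zero_le β
  · have h1 : 1 ≤ t ^ 10 := Nat.one_le_pow _ _ hpos
    have hn : (t ^ 10 + 1) ^ 5 * (t ^ 11) ^ 5 ≤ n := by
      calc (t ^ 10 + 1) ^ 5 * (t ^ 11) ^ 5 ≤ (2 * t ^ 10) ^ 5 * (t ^ 11) ^ 5 := by gcongr; omega
        _ = 32 * t ^ 105 := by ring
        _ ≤ n := ht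
    obtain ⟨G, hG⟩ := exists_graph (L := t ^ 10) (d := t ^ 11) (n := n) (Nat.pow_pos hpos) hn
    refine ⟨G, t, ht', fun H β h => (hG H β h).imp_right fun h' => le_trans (le_of_eq ?_) h'⟩
    ring

theorem theorem1 :
    ∃ G : (n : ℕ) → SimpleGraph (Fin n),
      ∀ C : ℝ, ∃ c : ℝ, 0 < c ∧ ∃ N : ℕ, ∀ n : ℕ, N ≤ n →
        ∀ (H : SimpleGraph (Fin n)) (β : ℕ),
          IsAdditiveSpanner (G n) H β →
          (H.edgeSet.ncard : ℝ) ≤ C * (n : ℝ) →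
          c * (n : ℝ) ^ ((2 : ℝ) / 21) ≤ (β : ℝ) := by
  choose G t hn hG using exists_graph_of_card
  refine ⟨G, fun C => ?_⟩
  -- As `t + 1 ≤ 2 * t`, there are at most `K * t ^ 105` vertices.
  obtain ⟨K, hK⟩ : ∃ K : ℝ, K = 32 * 2 ^ 105 := ⟨_, rfl⟩
  have hK0 : 0 < K := by rw [hK]; positivity
  obtain ⟨T, hT⟩ := exists_nat_gt (2 * |C| * K)
  refine ⟨(K ^ ((2 : ℝ) / 21))⁻¹, by positivity, 32 * (T + 1) ^ 105,
    fun n hNn H β hspan hedges => ?_⟩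
  have hTt : T + 1 ≤ t n := by
    have h := lt_of_mul_lt_mul_left (hNn.trans_lt (hn n)) (Nat.zero_le 32)
    have := lt_of_pow_lt_pow_left₀ 105 (Nat.zero_le _) h
    omega
  have hnK : (n : ℝ) ≤ K * (t n : ℝ) ^ 105 := by
    have h1 : (n : ℝ) ≤ 32 * ((t n : ℝ) + 1) ^ 105 := by exact_mod_cast (hn n).le
    have h2 : (t n : ℝ) + 1 ≤ 2 * t n := by
      have : (1 : ℝ) ≤ t n := by exact_mod_cast (show 1 ≤ t n by omega)
      linarith
    calc (n : ℝ) ≤ 32 * ((t n : ℝ) + 1) ^ 105 := h1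
      _ ≤ 32 * (2 * t n) ^ 105 := by gcongr
      _ = K * (t n : ℝ) ^ 105 := by rw [mul_pow, hK, mul_assoc]
  have htpos : (0 : ℝ) < t n := by exact_mod_cast (show 0 < t n by omega)
  rcases hG n H β hspan with h | h
  · rw [inv_mul_le_iff₀ (by positivity)]
    calc (n : ℝ) ^ ((2 : ℝ) / 21) ≤ (K * (t n : ℝ) ^ 105) ^ ((2 : ℝ) / 21) := by gcongr
      _ = K ^ ((2 : ℝ) / 21) * (t n : ℝ) ^ 10 := by
        rw [Real.mul_rpow hK0.le (by positivity), ← Real.rpow_natCast, ← Real.rpow_mul htpos.le,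
          ← Real.rpow_natCast _ 10]
        norm_num
      _ ≤ K ^ ((2 : ℝ) / 21) * β := by
        gcongr
        exact_mod_cast h
  · exfalso
    have h' : (t n : ℝ) ^ 106 ≤ 2 * (H.edgeSet.ncard : ℝ) := by exact_mod_cast h
    have h1 : (t n : ℝ) ^ 105 * t n ≤ (t n : ℝ) ^ 105 * (2 * |C| * K) := by
      calc (t n : ℝ) ^ 105 * t n = (t n : ℝ) ^ 106 := (pow_succ _ _).symm
        _ ≤ 2 * (C * n) := h'.trans (by linarith)
        _ ≤ 2 * (|C| * (K * (t n : ℝ) ^ 105)) := by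
          have : C * (n : ℝ) ≤ |C| * (K * (t n : ℝ) ^ 105) :=
            mul_le_mul (le_abs_self C) hnK (Nat.cast_nonneg n) (abs_nonneg C)
          linarith
        _ = (t n : ℝ) ^ 105 * (2 * |C| * K) := by ring
    have h2 := le_of_mul_le_mul_left h1 (by positivity)
    have h3 : (T : ℝ) + 1 ≤ t n := by exact_mod_cast hTt
    linarith
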